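/- Let $\mathbb K=\mathbb R$ or $\mathbb C$, let $f:\mathbb K^n\to\mathbb K^p$ be a polynomial mapping and let $\mathbf c\in\mathbb K^p$. Embed $\mathbb K^n$ in the projective space $\mathbb{KP}^n$ by $x\mapsto[x:1]$, with hyperplane at infinity $H_\infty=\mathbb{KP}^n\setminus\mathbb K^n$, and for $X\subset\mathbb K^n$ let $X^\infty=\overline{X}\cap H_\infty$, where $\overline X$ is the closure of $X$ in $\mathbb{KP}^n$ (for the Euclidean topology). Let the integer $m$ be defined by $$\dim_{\mathbb K}\big(f^{-1}(\mathbf c)\big)^\infty=n-1-m,\qquad\text{with the convention }\dim\emptyset=-1,$$ where $\dim_{\mathbb K}$ is the $\mathbb K$-dimension: the semialgebraic dimension for $\mathbb K=\mathbb R$ and the complex dimension for $\mathbb K=\mathbb C$ (in both cases the dimension of the Zariski closure). The value $\mathbf c$ is a *Lipschitz trivial value* of $f$ if there exist a neighbourhood $\mathcal V$ of $\mathbf c$ in $\mathbb K^p$ and a homeomorphism $H:f^{-1}(\mathbf c)\times\mathcal V\to f^{-1}(\mathcal V)$ with $f(H(x,t))=t$ for all $(x,t)$, which is bi-Lipschitz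 for the metrics induced by the Euclidean distances of $\mathbb K^n$ and $\mathbb K^p$ (the value need not be taken by $f$). A mapping $g:\mathbb K^m\to\mathbb K^p$ is *proper at* $\mathbf c$ if there is a neighbourhood $\mathcal V$ of $\mathbf c$ such that the restriction $g^{-1}(\mathcal V)\to\mathcal V$ is proper (empty mappings are proper), and $\mathbf c$ is a *regular value* of $g$ if the differential of $g$ is surjective at every point of $g^{-1}(\mathbf c)$. **Theorem.** The value $\mathbf c$ is a Lipschitz trivial value of $f$ if and only if there exist a surjective linear mapping $\pi:\mathbb K^n\to\mathbb K^m$ and a polynomial mapping $g:\mathbb K^m\to\mathbb K^p$ such that $\mathbf c$ is a regular value of $g$, $g$ is proper at $\mathbf c$, and $$f=g\circ\pi .$$ -/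

import Mathlib

open scoped LinearAlgebra.Projectivization Topology

noncomputable section

namespace LipTriv

/-- Quotient topology on a projective space (for `V = 𝕜ⁿ⁺¹`, the usual Euclidean topology of
`𝕜ℙⁿ`). -/
instance projTopology (𝕜 V : Type*) [DivisionRing 𝕜] [AddCommGroup V] [Module 𝕜 V]
    [TopologicalSpace V] : TopologicalSpace (ℙ 𝕜 V) :=
  TopologicalSpace.coinduced (Projectivization.mk' 𝕜) inferInstance

section Maps

variable {𝕜 : Type*} [RCLike 𝕜] {n p : ℕ}

/-- Polynomial mappings `𝕜ⁿ → 𝕜ᵖ`. -/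
def IsPolynomialMap (f : EuclideanSpace 𝕜 (Fin n) → EuclideanSpace 𝕜 (Fin p)) : Prop :=
  ∃ P : Fin p → MvPolynomial (Fin n) 𝕜,
    ∀ (x : EuclideanSpace 𝕜 (Fin n)) (j : Fin p), f x j = MvPolynomial.eval (fun i => x i) (P j)

/-- `f` is proper at the value `c`: over some neighbourhood `V` of `c`, the restriction
`f⁻¹(V) → V` is proper. -/
def IsProperAtValue (f : EuclideanSpace 𝕜 (Fin n) → EuclideanSpace 𝕜 (Fin p))
    (c : EuclideanSpace 𝕜 (Fin p)) : Prop :=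
  ∃ V ∈ 𝓝 c, IsProperMap (V.restrictPreimage f)

/-- Critical points of a (differentiable) mapping: the `𝕜`-differential is not surjective. -/
def criticalSet (f : EuclideanSpace 𝕜 (Fin n) → EuclideanSpace 𝕜 (Fin p)) :
    Set (EuclideanSpace 𝕜 (Fin n)) :=
  {x | ¬ Function.Surjective (fderiv 𝕜 f x)}

/-- `c` is a regular value: it is not a critical value (it need not be attained). -/
def IsRegularValue (f : EuclideanSpace 𝕜 (Fin n) → EuclideanSpace 𝕜 (Fin p))
    (c : EuclideanSpace 𝕜 (Fin p)) : Prop :=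
  c ∉ f '' criticalSet f

/-- `c` is a Lipschitz trivial value of `f`: there are a neighbourhood `V` of `c` and a
homeomorphism `H : f⁻¹(c) × V → f⁻¹(V)` with `f (H (x, t)) = t`, Lipschitz together with its
inverse. Subsets carry the restricted Euclidean distance, and the product the product metric. -/
def IsLipschitzTrivialValue (f : EuclideanSpace 𝕜 (Fin n) → EuclideanSpace 𝕜 (Fin p))
    (c : EuclideanSpace 𝕜 (Fin p)) : Prop :=
  ∃ V ∈ 𝓝 c, ∃ H : ((f ⁻¹' {c} : Set (EuclideanSpace 𝕜 (Fin n))) × V) ≃ₜ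
      (f ⁻¹' V : Set (EuclideanSpace 𝕜 (Fin n))),
    (∀ (x : (f ⁻¹' {c} : Set (EuclideanSpace 𝕜 (Fin n)))) (t : V),
      f (H (x, t) : EuclideanSpace 𝕜 (Fin n)) = t) ∧
    (∃ L, LipschitzWith L H) ∧ (∃ L, LipschitzWith L H.symm)

end Maps

section Infinity

variable {𝕜 : Type*} [RCLike 𝕜] {n : ℕ}

theorem snoc_one_ne_zero (x : EuclideanSpace 𝕜 (Fin n)) :
    (Fin.snoc (α := fun _ : Fin (n + 1) => 𝕜) (fun i => x i) 1) ≠ 0 := by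
  intro h
  have := congrFun h (Fin.last n)
  simp at this

/-- The embedding `𝕜ⁿ → 𝕜ℙⁿ`, `x ↦ [x : 1]`. -/
def affineEmb (x : EuclideanSpace 𝕜 (Fin n)) : ℙ 𝕜 (Fin (n + 1) → 𝕜) :=
  Projectivization.mk 𝕜 (Fin.snoc (α := fun _ : Fin (n + 1) => 𝕜) (fun i => x i) 1)
    (snoc_one_ne_zero x)

/-- The hyperplane at infinity `𝕜ℙⁿ \ 𝕜ⁿ`. -/
def hyperplaneAtInfinity (𝕜 : Type*) [RCLike 𝕜] (n : ℕ) : Set (ℙ 𝕜 (Fin (n + 1) → 𝕜)) :=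
  (Set.range (affineEmb (𝕜 := 𝕜) (n := n)))ᶜ

/-- The accumulation set at infinity of `X ⊆ 𝕜ⁿ`: the points at infinity of its closure
in `𝕜ℙⁿ`. -/
def accAtInfinity (X : Set (EuclideanSpace 𝕜 (Fin n))) : Set (ℙ 𝕜 (Fin (n + 1) → 𝕜)) :=
  closure (affineEmb '' X) ∩ hyperplaneAtInfinity 𝕜 n

/-- Dimension of a subset `A` of an affine space: the Krull dimension of `𝕜[x] / I(A)`, i.e. the
`𝕜`-dimension of the Zariski closure of `A`. For semialgebraic sets over `ℝ` this is the
semialgebraic dimension, for algebraic sets over `ℂ` the complex dimension.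
It is `⊥` for the empty set. -/
def affineDim {N : ℕ} (A : Set (Fin N → 𝕜)) : WithBot ℕ∞ :=
  ringKrullDim (MvPolynomial (Fin N) 𝕜 ⧸ MvPolynomial.vanishingIdeal 𝕜 A)

/-- The part of `S ⊆ 𝕜ℙᴺ⁻¹` in the `i`-th standard chart, the chart being identified with the
affine hyperplane `x i = 1` of `𝕜ᴺ`. -/
def chartPart {N : ℕ} (S : Set (ℙ 𝕜 (Fin N → 𝕜))) (i : Fin N) : Set (Fin N → 𝕜) :=
  {x | x i = 1 ∧ ∃ hx : x ≠ 0, Projectivization.mk 𝕜 x hx ∈ S}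

open Classical in
/-- Dimension of a subset of a projective space: the largest dimension of its parts in the
standard affine charts, with the convention `dim ∅ = -1`. (It is always finite: the dimension of
each chart part is at most `N`.) -/
def projDim {N : ℕ} (S : Set (ℙ 𝕜 (Fin N → 𝕜))) : ℤ :=
  if S = ∅ then -1 else (((⨆ i, affineDim (chartPart S i)).unbotD 0).toNat : ℤ)

end Infinity

end LipTriv

end

/-! Let `A = f ⁻¹' {c}` and let `B = asymptoticSpace 𝕜 A` be the common kernel of the linear
functionals bounded on `A`; by duality, `A` is bounded modulo `B`.

Necessity. Bi-Lipschitz triviality makes `f` Lipschitz over a neighbourhood of `c`, so all small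
translates of `f` are bounded on `A`. For a polynomial this forces invariance under `B`
(`DifferenceDegreeLT.invariant`). Hence `A` is a union of cosets of `B`, its accumulation set at
infinity is exactly the projectivization of `B` (`mk_mem_accAtInfinity_iff`), and the definition of
`m` gives `dim B = n - m`. Thus `f` descends to a polynomial `g` on the quotient by `B`, identified
with `𝕜ᵐ`. Lipschitz sections make `c` regular (`surjective_fderiv_of_section`); properness holds
because nearby fibers lie close to `A`, whose image modulo `B` is bounded.

Sufficiency. Over a small closed ball around `c`, `g` is a submersion with compact preimage. A
compactly supported `C¹` right inverse of its differential, up to a cutoff, lifts translations of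
the target to time-one flows, which are Lipschitz in point and direction
(`exists_lipschitz_transport`). Leaving a complement of the image of a linear section of `π`
untouched lifts this transport to `𝕜ⁿ` and trivializes `f`. -/

noncomputable section

namespace LipTriv

/-! ### Dimension of affine and projectivized linear subspaces -/

section Dimension

open MvPolynomial

variable {𝕜 : Type*} [RCLike 𝕜] {N : ℕ}

theorem affineDim_empty : affineDim (∅ : Set (Fin N → 𝕜)) = ⊥ := by
  rw [affineDim, vanishingIdeal_empty]
  have : Subsingleton (MvPolynomial (Fin N) 𝕜 ⧸ (⊤ : Ideal (MvPolynomial (Fin N) 𝕜))) :=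
    Ideal.Quotient.subsingleton_iff.2 rfl
  exact ringKrullDim_eq_bot_of_subsingleton

/-- The dimension of an affine subspace is the dimension of its direction. -/
theorem affineDim_translate (x₀ : Fin N → 𝕜) (W : Submodule 𝕜 (Fin N → 𝕜)) :
    affineDim {x | x - x₀ ∈ W} = (Module.finrank 𝕜 W : WithBot ℕ∞) := by
  -- Pulling back along `t ↦ x₀ + ∑ tⱼ bⱼ` maps polynomials onto a polynomial ring in `dim W`
  -- variables, with the vanishing ideal as kernel.
  set b := Module.finBasis 𝕜 W
  obtain ⟨r, hr⟩ := W.subtype.exists_leftInverse_of_injective (Submodule.ker_subtype W)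
  set φ : MvPolynomial (Fin N) 𝕜 →ₐ[𝕜] MvPolynomial (Fin (Module.finrank 𝕜 W)) 𝕜 :=
    aeval fun i => C (x₀ i) + ∑ j, C ((b j : Fin N → 𝕜) i) * X j with hφ
  have heval (t : Fin (Module.finrank 𝕜 W) → 𝕜) (P : MvPolynomial (Fin N) 𝕜) :
      eval t (φ P) = aeval (x₀ + ∑ j, t j • (b j : Fin N → 𝕜)) P := by
    induction P using MvPolynomial.induction_on with
    | C a => simp [hφ]
    | add p q hp hq => simp only [map_add, hp, hq]
    | mul_X p i hp =>
      simp only [map_mul, hp]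
      congr 1
      simp [hφ, Finset.sum_apply, mul_comm]
  have hsurj : Function.Surjective φ := by
    rw [← AlgHom.range_eq_top, eq_top_iff, ← MvPolynomial.adjoin_range_X, Algebra.adjoin_le_iff]
    rintro _ ⟨j, rfl⟩
    -- The projection `r` extends the `j`-th coordinate on `W` to the ambient space; recentred at
    -- `x₀`, this linear form pulls back to `X j`.
    refine ⟨∑ i, C (b.repr (r (Pi.single i 1)) j) * (X i - C (x₀ i)), ?_⟩
    have hcoord (l) : ∑ i, b.repr (r (Pi.single i 1)) j * (b l : Fin N → 𝕜) i
        = if l = j then 1 else 0 := by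
      have h1 : (b l : Fin N → 𝕜) = ∑ i, (b l : Fin N → 𝕜) i • Pi.single i (1 : 𝕜) := by
        ext i; simp [Finset.sum_apply, Pi.single_apply]
      have h2 : r (b l : Fin N → 𝕜) = b l := LinearMap.congr_fun hr (b l)
      have h3 : b.repr (r (b l : Fin N → 𝕜)) j = if l = j then 1 else 0 := by
        rw [h2, b.repr_self, Finsupp.single_apply]
      rw [← h3]
      conv_rhs => rw [h1]
      simp [Finsupp.finsetSum_apply, mul_comm]
    simp only [hφ, AlgHom.toRingHom_eq_coe, RingHom.coe_coe, map_sum, map_mul, map_sub, aeval_X,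
      algHom_C, MvPolynomial.algebraMap_eq, add_sub_cancel_left, Finset.mul_sum]
    rw [Finset.sum_comm]
    simp_rw [← mul_assoc, ← Finset.sum_mul, ← C_mul, ← map_sum, hcoord]
    simp
  have hker : RingHom.ker φ = vanishingIdeal 𝕜 {x | x - x₀ ∈ W} := by
    ext P
    rw [RingHom.mem_ker, mem_vanishingIdeal_iff]
    constructor
    · intro h x hx
      have hx' : x = x₀ + ∑ j, b.repr ⟨x - x₀, hx⟩ j • (b j : Fin N → 𝕜) := by
        have := congrArg (Subtype.val) (b.sum_repr ⟨x - x₀, hx⟩)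
        simp only [AddSubmonoidClass.coe_finsetSum, Submodule.coe_smul] at this
        rw [this]; abel
      rw [hx', ← heval, h, map_zero]
    · intro h
      refine MvPolynomial.funext fun t => ?_
      rw [heval, map_zero]
      refine h _ ?_
      simp only [Set.mem_ofPred_eq, add_sub_cancel_left]
      exact Submodule.sum_mem _ fun j _ => W.smul_mem _ (b j).2
  rw [affineDim, ← hker,
    ringKrullDim_eq_of_ringEquiv (Ideal.quotientKerAlgEquivOfSurjective hsurj).toRingEquiv,
    MvPolynomial.ringKrullDim_of_isNoetherianRing, ringKrullDim_eq_zero_of_field]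
  simp

/-- The projective dimension of a projectivized linear subspace. -/
theorem projDim_submodule (W : Submodule 𝕜 (Fin N → 𝕜)) (S : Set (ℙ 𝕜 (Fin N → 𝕜)))
    (hS : ∀ x hx, Projectivization.mk 𝕜 x hx ∈ S ↔ x ∈ W) :
    projDim S = (Module.finrank 𝕜 W : ℤ) - 1 := by
  have hchart (i) : chartPart S i = {x | x i = 1 ∧ x ∈ W} := by
    ext x
    simp only [chartPart, Set.mem_ofPred_eq]
    refine and_congr_right fun hx => ⟨fun ⟨h0, h⟩ => (hS x h0).1 h, fun h => ?_⟩
    have h0 : x ≠ 0 := by rintro rfl; simp at hx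
    exact ⟨h0, (hS x h0).2 h⟩
  have hmem (i) (x₀ : Fin N → 𝕜) (h₀ : x₀ i ≠ 0) (hW : x₀ ∈ W) :
      affineDim (chartPart S i) = ((Module.finrank 𝕜 W - 1 : ℕ) : WithBot ℕ∞) := by
    -- A nonempty chart part is a level set of the nonzero form `ℓ`, hence a coset of its kernel, of
    -- dimension `dim W - 1`.
    set ℓ : W →ₗ[𝕜] 𝕜 := (LinearMap.proj i).comp W.subtype
    have hrange : LinearMap.range ℓ = ⊤ := by
      rw [LinearMap.range_eq_top]
      intro a
      refine ⟨(a / x₀ i) • ⟨x₀, hW⟩, ?_⟩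
      simp [ℓ, h₀]
    have hfin := LinearMap.finrank_range_add_finrank_ker ℓ
    rw [hrange, finrank_top, Module.finrank_self] at hfin
    have hset : chartPart S i
        = {x | x - (x₀ i)⁻¹ • x₀ ∈ (LinearMap.ker ℓ).map W.subtype} := by
      rw [hchart]
      ext x
      simp only [Set.mem_ofPred_eq, Submodule.mem_map, LinearMap.mem_ker]
      constructor
      · rintro ⟨h1, h2⟩
        refine ⟨⟨x - (x₀ i)⁻¹ • x₀, W.sub_mem h2 (W.smul_mem _ hW)⟩, ?_, rfl⟩
        simp [ℓ, h1, h₀]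
      · rintro ⟨y, hy, hyx⟩
        have hx : x = y + (x₀ i)⁻¹ • x₀ := by rw [← sub_eq_iff_eq_add, ← hyx]; rfl
        have hy' : (y : Fin N → 𝕜) i = 0 := hy
        rw [hx]
        exact ⟨by simp [hy', h₀], W.add_mem y.2 (W.smul_mem _ hW)⟩
    rw [hset, affineDim_translate, LinearEquiv.finrank_eq
      (Submodule.equivMapOfInjective W.subtype W.injective_subtype _).symm]
    congr 2
    omega
  by_cases hW : W = ⊥
  · have : S = ∅ := by
      ext z
      induction z using Projectivization.ind with
      | h x hx => simp [hS, hW, hx]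
    subst hW
    simp [projDim, this]
  · obtain ⟨x₀, h₀, hne⟩ := Submodule.exists_mem_ne_zero_of_ne_bot hW
    obtain ⟨i, hi⟩ := Function.ne_iff.1 hne
    have hSne : S ≠ ∅ := Set.Nonempty.ne_empty ⟨_, (hS x₀ hne).2 h₀⟩
    have hsup : (⨆ i, affineDim (chartPart S i))
        = ((Module.finrank 𝕜 W - 1 : ℕ) : WithBot ℕ∞) := by
      refine le_antisymm (iSup_le fun j => ?_) (le_iSup_of_le i (hmem i x₀ hi h₀).ge)
      rcases (chartPart S j).eq_empty_or_nonempty with h | ⟨x, hx⟩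
      · rw [h, affineDim_empty]; exact bot_le
      · rw [hchart] at hx
        exact (hmem j x (by rw [hx.1]; exact one_ne_zero) hx.2).le
    have hpos : 0 < Module.finrank 𝕜 W := by
      rw [Nat.pos_iff_ne_zero, Ne, Submodule.finrank_eq_zero]; exact hW
    rw [projDim, if_neg hSne, hsup]
    have : ((((Module.finrank 𝕜 W - 1 : ℕ) : WithBot ℕ∞)).unbotD 0).toNat
        = Module.finrank 𝕜 W - 1 := rfl
    rw [this]
    omega

end Dimension

/-! ### Degree bounds through finite differences -/

section Differences

variable {R : Type*} [CommRing R] {E : Type*} [AddCommGroup E]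

/-- `P` is annihilated by `k` successive finite differences. -/
def DifferenceDegreeLT : ℕ → (E → R) → Prop
  | 0, P => P = 0
  | k + 1, P => ∀ h, DifferenceDegreeLT k fun x => P (x + h) - P x

namespace DifferenceDegreeLT

theorem zero (k : ℕ) : DifferenceDegreeLT k (0 : E → R) := by
  induction k with
  | zero => rfl
  | succ k ih =>
    intro h
    convert ih using 1
    ext x
    simp

theorem succ {k : ℕ} {P : E → R} (hP : DifferenceDegreeLT k P) : DifferenceDegreeLT (k + 1) P := by
  induction k generalizing P with
  | zero =>
    obtain rfl : P = 0 := hP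
    exact zero 1
  | succ k ih => exact fun h => ih (hP h)

theorem mono {k l : ℕ} (hkl : k ≤ l) {P : E → R} (hP : DifferenceDegreeLT k P) :
    DifferenceDegreeLT l P := by
  induction hkl with
  | refl => exact hP
  | step _ ih => exact ih.succ

theorem add {k : ℕ} {P Q : E → R} (hP : DifferenceDegreeLT k P) (hQ : DifferenceDegreeLT k Q) :
    DifferenceDegreeLT k fun x => P x + Q x := by
  induction k generalizing P Q with
  | zero =>
    obtain rfl : P = 0 := hP
    obtain rfl : Q = 0 := hQ
    ext x
    simp
  | succ k ih =>
    intro h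
    convert ih (hP h) (hQ h) using 1
    ext x
    ring

theorem comp_add {k : ℕ} {P : E → R} (hP : DifferenceDegreeLT k P) (a : E) :
    DifferenceDegreeLT k fun x => P (x + a) := by
  induction k generalizing P with
  | zero =>
    obtain rfl : P = 0 := hP
    rfl
  | succ k ih =>
    intro h
    convert ih (hP h) using 1
    ext x
    rw [add_right_comm]

/-- Induction on `k + l` by the discrete Leibniz rule `Δ(PQ) = ΔP · Q(· + h) + P · ΔQ`. The bound is
not sharp, but only finiteness matters later. -/
theorem mul {k l : ℕ} {P Q : E → R} (hP : DifferenceDegreeLT k P) (hQ : DifferenceDegreeLT l Q) :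
    DifferenceDegreeLT (k + l) fun x => P x * Q x := by
  induction hs : k + l generalizing k l P Q with
  | zero =>
    obtain rfl : k = 0 := by omega
    obtain rfl : P = 0 := hP
    ext x
    simp
  | succ s ih =>
    cases k with
    | zero =>
      obtain rfl : P = 0 := hP
      convert zero (s + 1) using 1
      ext x
      simp
    | succ k =>
      cases l with
      | zero =>
        obtain rfl : Q = 0 := hQ
        convert zero (s + 1) using 1
        ext x
        simp
      | succ l =>
        intro h
        convert (ih (hP h) (hQ.comp_add h) (by omega)).add (ih hP (hQ h) (by omega)) using 1
        ext x
        ring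

theorem const (a : R) : DifferenceDegreeLT 1 fun _ : E => a := by
  intro h
  ext x
  simp

theorem linear [Module R E] (ℓ : E →ₗ[R] R) : DifferenceDegreeLT 2 fun x : E => ℓ x := by
  intro h
  convert const (ℓ h) using 1
  ext x
  simp

end DifferenceDegreeLT

end Differences

/-! ### Asymptotic space and invariance of polynomials -/

section Asymptotic

variable {𝕜 : Type*} [RCLike 𝕜] {E : Type*} [NormedAddCommGroup E] [NormedSpace 𝕜 E]

/-- The linear functionals that are bounded on a set. -/
def boundedDual (𝕜 : Type*) [RCLike 𝕜] {E : Type*} [NormedAddCommGroup E] [NormedSpace 𝕜 E]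
    (A : Set E) : Submodule 𝕜 (Module.Dual 𝕜 E) where
  carrier := {ℓ | ∃ M : ℝ, ∀ x ∈ A, ‖ℓ x‖ ≤ M}
  zero_mem' := ⟨0, fun x _ => by simp⟩
  add_mem' := by
    rintro ℓ₁ ℓ₂ ⟨M₁, h₁⟩ ⟨M₂, h₂⟩
    exact ⟨M₁ + M₂, fun x hx => (norm_add_le _ _).trans (add_le_add (h₁ x hx) (h₂ x hx))⟩
  smul_mem' := by
    rintro a ℓ ⟨M, h⟩
    refine ⟨‖a‖ * M, fun x hx => ?_⟩
    rw [LinearMap.smul_apply, norm_smul]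
    exact mul_le_mul_of_nonneg_left (h x hx) (norm_nonneg a)

/-- The smallest linear subspace modulo which a set is bounded. -/
def asymptoticSpace (𝕜 : Type*) [RCLike 𝕜] {E : Type*} [NormedAddCommGroup E] [NormedSpace 𝕜 E]
    (A : Set E) : Submodule 𝕜 E :=
  (boundedDual 𝕜 A).dualCoannihilator

theorem apply_eq_zero_of_mem_asymptoticSpace {A : Set E} {u : E} (hu : u ∈ asymptoticSpace 𝕜 A)
    {ℓ : Module.Dual 𝕜 E} (hℓ : ∃ M : ℝ, ∀ x ∈ A, ‖ℓ x‖ ≤ M) : ℓ u = 0 :=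
  (Submodule.mem_dualCoannihilator u).1 hu ℓ hℓ

theorem asymptoticSpace_empty : asymptoticSpace 𝕜 (∅ : Set E) = ⊥ := by
  rw [eq_bot_iff]
  intro u hu
  rw [Submodule.mem_bot, ← Module.forall_dual_apply_eq_zero_iff 𝕜]
  exact fun ℓ => apply_eq_zero_of_mem_asymptoticSpace hu ⟨0, fun x hx => hx.elim⟩

/-- A linear map vanishing on the asymptotic space of a set is bounded on this set. -/
theorem exists_norm_le_of_asymptoticSpace_le_ker [FiniteDimensional 𝕜 E] {F : Type*}
    [NormedAddCommGroup F] [NormedSpace 𝕜 F] [FiniteDimensional 𝕜 F] {A : Set E}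
    (T : E →ₗ[𝕜] F) (hT : asymptoticSpace 𝕜 A ≤ LinearMap.ker T) :
    ∃ M : ℝ, ∀ x ∈ A, ‖T x‖ ≤ M := by
  set b := Module.finBasis 𝕜 F
  have h (i) : ∃ M : ℝ, ∀ x ∈ A, ‖b.coord i (T x)‖ ≤ M := by
    -- In finite dimension the double annihilator of the bounded functionals is that space itself,
    -- so each coordinate of `T` is bounded on `A`.
    have : (b.coord i).comp T ∈ (boundedDual 𝕜 A).dualCoannihilator.dualAnnihilator := by
      rw [Submodule.mem_dualAnnihilator]
      intro w hw
      have : T w = 0 := hT hw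
      simp [this]
    rwa [Subspace.dualCoannihilator_dualAnnihilator_eq] at this
  choose M hM using h
  refine ⟨∑ i, M i * ‖b i‖, fun x hx => ?_⟩
  rw [← b.sum_repr (T x)]
  refine (norm_sum_le _ _).trans (Finset.sum_le_sum fun i _ => ?_)
  rw [norm_smul]
  exact mul_le_mul_of_nonneg_right (hM i x hx) (norm_nonneg _)

/-- A polynomial function all of whose small translates are bounded on `A` is invariant under
the asymptotic space of `A`. -/
theorem DifferenceDegreeLT.invariant [FiniteDimensional 𝕜 E] {A : Set E} {k : ℕ} {P : E → 𝕜}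
    (hP : DifferenceDegreeLT k P) (hd : Differentiable 𝕜 P) {r : ℝ} (hr : 0 < r)
    (hb : ∀ h : E, ‖h‖ < r → ∃ M : ℝ, ∀ x ∈ A, ‖P (x + h)‖ ≤ M)
    {u : E} (hu : u ∈ asymptoticSpace 𝕜 A) (x : E) : P (x + u) = P x := by
  induction k generalizing P r u x with
  | zero =>
    obtain rfl : P = 0 := hP
    rfl
  | succ k ih =>
    have hdiff (a : E) : Differentiable 𝕜 fun x => P (x + a) :=
      hd.comp (differentiable_id.add_const a)
    -- The induction hypothesis applies to the difference of `P` in direction `h`; halving the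
    -- radius keeps both `h'` and `h' + h` admissible translates.
    have hQ (h : E) (hh : ‖h‖ < r / 2) {u : E} (hu : u ∈ asymptoticSpace 𝕜 A) (x : E) :
        P (x + h + u) - P (x + h) = P (x + u) - P x := by
      have := ih (hP h) ((hdiff h).sub hd) (half_pos hr) (fun h' hh' => ?_) hu x
      · rw [add_right_comm x h u]
        linear_combination this
      · have h1 : ‖h' + h‖ < r := (norm_add_le _ _).trans_lt (by linarith)
        obtain ⟨M₁, hM₁⟩ := hb _ h1
        obtain ⟨M₂, hM₂⟩ := hb h' (by linarith)
        refine ⟨M₁ + M₂, fun x hx => (norm_sub_le _ _).trans (add_le_add ?_ (hM₂ x hx))⟩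
        rw [add_assoc]
        exact hM₁ x hx
    -- By `hQ` the increment along `u` is locally constant in `x`, hence constant.
    have hconst {u : E} (hu : u ∈ asymptoticSpace 𝕜 A) (x : E) :
        P (x + u) - P x = P u - P 0 := by
      have hdR : Differentiable 𝕜 fun x => P (x + u) - P x := (hdiff u).sub hd
      have := is_const_of_fderiv_eq_zero hdR (fun y => ?_) x 0
      · simpa using this
      · have hloc : (fun x => P (x + u) - P x) =ᶠ[𝓝 y] fun _ => P (y + u) - P y := by
          filter_upwards [Metric.ball_mem_nhds y (half_pos hr)] with z hz
          have := hQ (z - y) (by rwa [← dist_eq_norm]) hu y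
          rwa [add_sub_cancel] at this
        rw [hloc.fderiv_eq]
        simp
    set D := fderiv 𝕜 P 0 with hD
    have hfd {v : E} (hv : v ∈ asymptoticSpace 𝕜 A) : fderiv 𝕜 P v = D := by
      have h1 : (fun x => P (x + v)) = fun x => P x + (P v - P 0) := by
        ext x
        rw [← hconst hv x]
        ring
      have h2 := fderiv_comp_add_right (𝕜 := 𝕜) (f := P) (x := 0) v
      rw [h1, zero_add, fderiv_add_const] at h2
      exact h2.symm
    have hlin {u : E} (hu : u ∈ asymptoticSpace 𝕜 A) : P u - P 0 = D u := by
      have hder (t : 𝕜) : HasDerivAt (fun t : 𝕜 => P (t • u) - t * D u) 0 t := by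
        have h1 : HasDerivAt (fun t : 𝕜 => t • u) u t := by
          simpa using (hasDerivAt_id t).smul_const u
        have h2 : HasFDerivAt P D (t • u) := by
          rw [← hfd (Submodule.smul_mem _ t hu)]
          exact (hd _).hasFDerivAt
        have h3 := (h2.comp_hasDerivAt t h1).sub ((hasDerivAt_id t).mul_const (D u))
        rw [one_mul, sub_self] at h3
        exact h3
      have := is_const_of_deriv_eq_zero (fun t => (hder t).differentiableAt)
        (fun t => (hder t).deriv) 1 0
      simp only [one_smul, one_mul, zero_smul, zero_mul, sub_zero] at this
      linear_combination this
    obtain ⟨q, hq⟩ := (asymptoticSpace 𝕜 A).subtype.exists_leftInverse_of_injective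
      (Submodule.ker_subtype _)
    have hqu {u : E} (hu : u ∈ asymptoticSpace 𝕜 A) : (q u : E) = u :=
      congrArg Subtype.val (LinearMap.congr_fun hq ⟨u, hu⟩)
    -- Write `x = q x + T x` with `T x` bounded on `A`. Then `D (q x) = P x - P (T x)` is bounded on
    -- `A`, so `D ∘ q` is a bounded functional and must vanish on the asymptotic space.
    set T : E →ₗ[𝕜] E := LinearMap.id - (asymptoticSpace 𝕜 A).subtype.comp q with hT
    obtain ⟨M, hM⟩ := exists_norm_le_of_asymptoticSpace_le_ker (A := A) T fun u hu => by
      simp [hT, hqu hu]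
    have hproper : ProperSpace E := FiniteDimensional.proper 𝕜 E
    obtain ⟨M₁, hM₁⟩ := (isCompact_closedBall (0 : E) M).exists_bound_of_continuousOn
      hd.continuous.continuousOn
    obtain ⟨M₂, hM₂⟩ := hb 0 (by simpa using hr)
    have hDu : D u = 0 := by
      have := apply_eq_zero_of_mem_asymptoticSpace hu
        (ℓ := (D : E →ₗ[𝕜] 𝕜).comp ((asymptoticSpace 𝕜 A).subtype.comp q))
        ⟨M₂ + M₁, fun x hx => ?_⟩
      · simpa [hqu hu] using this
      · have h1 := hconst (q x).2 (T x)
        rw [hlin (q x).2] at h1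
        have h2 : T x + q x = x := by simp [hT]
        rw [h2] at h1
        simp only [LinearMap.comp_apply, Submodule.subtype_apply, ContinuousLinearMap.coe_coe]
        rw [← h1]
        refine (norm_sub_le _ _).trans (add_le_add ?_ (hM₁ _ ?_))
        · simpa using hM₂ x hx
        · simpa using hM x hx
    have := hconst hu x
    rw [hlin hu, hDu] at this
    exact sub_eq_zero.1 this

end Asymptotic

/-! ### The accumulation set at infinity -/

section AccumulationSet

variable {𝕜 : Type*} [RCLike 𝕜] {n : ℕ}

/-- The inclusion of `𝕜ⁿ` in `𝕜ⁿ⁺¹` as the hyperplane where the last coordinate vanishes. -/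
def snocZero (𝕜 : Type*) [RCLike 𝕜] (n : ℕ) : EuclideanSpace 𝕜 (Fin n) →ₗ[𝕜] (Fin (n + 1) → 𝕜) where
  toFun u := Fin.snoc (α := fun _ : Fin (n + 1) => 𝕜) (fun i => u i) 0
  map_add' u v := by
    ext i
    refine Fin.lastCases ?_ (fun j => ?_) i <;> simp
  map_smul' a u := by
    ext i
    refine Fin.lastCases ?_ (fun j => ?_) i <;> simp

@[simp]
theorem snocZero_last (u : EuclideanSpace 𝕜 (Fin n)) : snocZero 𝕜 n u (Fin.last n) = 0 := by
  simp [snocZero]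

@[simp]
theorem snocZero_castSucc (u : EuclideanSpace 𝕜 (Fin n)) (i : Fin n) :
    snocZero 𝕜 n u i.castSucc = u i := by
  simp [snocZero]

theorem snocZero_injective : Function.Injective (snocZero 𝕜 n) := by
  intro u v h
  ext i
  simpa using congrFun h i.castSucc

theorem snoc_eq_snocZero_add (u : EuclideanSpace 𝕜 (Fin n)) (a : 𝕜) :
    Fin.snoc (α := fun _ : Fin (n + 1) => 𝕜) (fun i => u i) a
      = snocZero 𝕜 n u + Pi.single (Fin.last n) a := by
  ext i
  refine Fin.lastCases ?_ (fun j => ?_) i <;> simp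

theorem mk_mem_hyperplaneAtInfinity {x : Fin (n + 1) → 𝕜} (hx : x ≠ 0) :
    Projectivization.mk 𝕜 x hx ∈ hyperplaneAtInfinity 𝕜 n ↔ x (Fin.last n) = 0 := by
  rw [hyperplaneAtInfinity, Set.mem_compl_iff, not_iff_comm]
  constructor
  · intro h
    refine ⟨WithLp.toLp 2 fun i => (x (Fin.last n))⁻¹ * x i.castSucc, ?_⟩
    rw [affineEmb, Projectivization.mk_eq_mk_iff']
    refine ⟨(x (Fin.last n))⁻¹, ?_⟩
    ext i
    refine Fin.lastCases ?_ (fun j => ?_) i <;> simp [h]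
  · rintro ⟨y, hy⟩ h0
    rw [affineEmb, Projectivization.mk_eq_mk_iff'] at hy
    obtain ⟨a, ha⟩ := hy
    have := congrFun ha (Fin.last n)
    simp [h0] at this

theorem continuous_mk' (V : Type*) [AddCommGroup V] [Module 𝕜 V] [TopologicalSpace V] :
    Continuous (Projectivization.mk' 𝕜 (V := V)) :=
  continuous_coinduced_rng

/-- The accumulation set at infinity of a set that is a union of cosets of its asymptotic space. -/
theorem mk_mem_accAtInfinity_iff {A : Set (EuclideanSpace 𝕜 (Fin n))}
    (hA : ∀ u ∈ asymptoticSpace 𝕜 A, ∀ x ∈ A, x + u ∈ A) (w : Fin (n + 1) → 𝕜) (hw : w ≠ 0) :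
    Projectivization.mk 𝕜 w hw ∈ accAtInfinity A ↔
      w ∈ (asymptoticSpace 𝕜 A).map (snocZero 𝕜 n) := by
  rw [accAtInfinity, Set.mem_inter_iff, mk_mem_hyperplaneAtInfinity, Submodule.mem_map]
  constructor
  · rintro ⟨hcl, hlast⟩
    set u : EuclideanSpace 𝕜 (Fin n) := WithLp.toLp 2 fun i => w i.castSucc with hu
    have huw : snocZero 𝕜 n u = w := by
      ext i
      refine Fin.lastCases ?_ (fun j => ?_) i <;> simp [hlast, hu]
    refine ⟨u, (Submodule.mem_dualCoannihilator u).2 ?_, huw⟩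
    rintro ℓ ⟨M, hM⟩
    set L : (Fin (n + 1) → 𝕜) →ₗ[𝕜] 𝕜 := ℓ.comp
      ({ toFun := fun x => WithLp.toLp 2 fun i : Fin n => x i.castSucc
         map_add' := fun _ _ => rfl
         map_smul' := fun _ _ => rfl } : (Fin (n + 1) → 𝕜) →ₗ[𝕜] EuclideanSpace 𝕜 (Fin n)) with hL
    -- The bound on `ℓ`, homogenized, is a closed condition on projective space, independent of the
    -- representative; at infinity it reads `ℓ u = 0`.
    set Z : Set (ℙ 𝕜 (Fin (n + 1) → 𝕜)) := {z | ‖L z.rep‖ ≤ M * ‖z.rep (Fin.last n)‖} with hZ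
    have hmem (x : Fin (n + 1) → 𝕜) (hx : x ≠ 0) :
        Projectivization.mk 𝕜 x hx ∈ Z ↔ ‖L x‖ ≤ M * ‖x (Fin.last n)‖ := by
      obtain ⟨a, ha⟩ := Projectivization.exists_smul_eq_mk_rep 𝕜 x hx
      have ha0 : 0 < ‖(a : 𝕜)‖ := norm_pos_iff.2 a.ne_zero
      simp only [hZ, Set.mem_ofPred_eq, ← ha, Units.smul_def, map_smul, Pi.smul_apply, smul_eq_mul,
        norm_mul]
      rw [mul_left_comm, mul_le_mul_iff_right₀ ha0]
    have hclosed : IsClosed Z := by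
      rw [← isOpen_compl_iff, isOpen_coinduced, Set.preimage_compl, isOpen_compl_iff]
      have : Projectivization.mk' 𝕜 ⁻¹' Z
          = {x : {v : Fin (n + 1) → 𝕜 // v ≠ 0} | ‖L x‖ ≤ M * ‖(x : Fin (n + 1) → 𝕜) (Fin.last n)‖} := by
        ext x
        exact hmem x.1 x.2
      rw [this]
      have hLc : Continuous L := L.continuous_of_finiteDimensional
      exact isClosed_le (hLc.comp continuous_subtype_val).norm
        (continuous_const.mul ((continuous_apply _).comp continuous_subtype_val).norm)
    have hsub : affineEmb '' A ⊆ Z := by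
      rintro _ ⟨x, hx, rfl⟩
      rw [affineEmb, hmem]
      have hLx : L (Fin.snoc (α := fun _ : Fin (n + 1) => 𝕜) (fun i => x i) 1) = ℓ x := by
        change ℓ _ = ℓ x
        congr 1
        ext i
        exact Fin.snoc_castSucc (α := fun _ : Fin (n + 1) => 𝕜) _ _ _
      rw [hLx, Fin.snoc_last, norm_one, mul_one]
      exact hM x hx
    have := (hmem w hw).1 (closure_minimal hsub hclosed hcl)
    rw [hlast, norm_zero, mul_zero] at this
    exact norm_le_zero_iff.1 this
  · rintro ⟨u, hu, rfl⟩
    refine ⟨?_, snocZero_last u⟩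
    obtain ⟨x, hx⟩ : A.Nonempty := by
      by_contra h
      rw [Set.not_nonempty_iff_eq_empty] at h
      rw [h, asymptoticSpace_empty, Submodule.mem_bot] at hu
      exact hw (by rw [hu, map_zero])
    have hne (t : ℝ) : snocZero 𝕜 n u + (t : 𝕜) • (snocZero 𝕜 n x + Pi.single (Fin.last n) 1) ≠ 0 := by
      intro h
      have ht : (t : 𝕜) = 0 := by simpa using congrFun h (Fin.last n)
      rw [ht, zero_smul, add_zero] at h
      exact hw h
    -- The path `[u + t x : t]` equals `[x + t⁻¹ u : 1]` for `t ≠ 0`, a point of `A`, and tends to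
    -- `[u : 0]`.
    set γ : ℝ → ℙ 𝕜 (Fin (n + 1) → 𝕜) := fun t => Projectivization.mk' 𝕜 ⟨_, hne t⟩ with hγ
    have hcont : Continuous γ := by
      refine (continuous_mk' _).comp (Continuous.subtype_mk ?_ _)
      have : Continuous fun t : ℝ => (t : 𝕜) := RCLike.continuous_ofReal
      fun_prop
    have h0 : γ 0 = Projectivization.mk 𝕜 (snocZero 𝕜 n u) hw := by
      simp [hγ, Projectivization.mk'_eq_mk]
    rw [← h0]
    refine mem_closure_of_tendsto (b := 𝓝[≠] (0 : ℝ)) (hcont.continuousAt.tendsto.mono_left nhdsWithin_le_nhds) ?_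
    filter_upwards [self_mem_nhdsWithin] with t ht
    have ht' : (t : 𝕜) ≠ 0 := by simpa using ht
    refine ⟨x + (t : 𝕜)⁻¹ • u, hA _ (Submodule.smul_mem _ _ hu) x hx, ?_⟩
    simp only [hγ]
    rw [affineEmb, Projectivization.mk'_eq_mk, Projectivization.mk_eq_mk_iff']
    refine ⟨(t : 𝕜)⁻¹, ?_⟩
    rw [snoc_eq_snocZero_add, map_add, map_smul, smul_add, smul_smul, inv_mul_cancel₀ ht', one_smul]
    abel

theorem projDim_accAtInfinity {A : Set (EuclideanSpace 𝕜 (Fin n))}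
    (hA : ∀ u ∈ asymptoticSpace 𝕜 A, ∀ x ∈ A, x + u ∈ A) :
    projDim (accAtInfinity A) = (Module.finrank 𝕜 (asymptoticSpace 𝕜 A) : ℤ) - 1 := by
  rw [projDim_submodule _ _ (mk_mem_accAtInfinity_iff hA),
    LinearEquiv.finrank_eq (Submodule.equivMapOfInjective _ snocZero_injective _).symm]

end AccumulationSet

/-! ### Polynomial mappings -/

section Polynomial

variable {𝕜 : Type*} [RCLike 𝕜] {n p : ℕ}

theorem contDiff_eval (P : MvPolynomial (Fin n) 𝕜) {k : WithTop ℕ∞} :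
    ContDiff 𝕜 k fun x : EuclideanSpace 𝕜 (Fin n) => MvPolynomial.eval (fun i => x i) P := by
  induction P using MvPolynomial.induction_on with
  | C a => simpa using contDiff_const
  | add p q hp hq => simpa using hp.add hq
  | mul_X p i hp =>
    simp only [map_mul, MvPolynomial.eval_X]
    exact hp.mul (by fun_prop)

theorem IsPolynomialMap.contDiff {f : EuclideanSpace 𝕜 (Fin n) → EuclideanSpace 𝕜 (Fin p)}
    (hf : IsPolynomialMap f) {k : WithTop ℕ∞} : ContDiff 𝕜 k f := by
  obtain ⟨P, hP⟩ := hf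
  rw [contDiff_euclidean]
  intro j
  simp only [hP]
  exact contDiff_eval (P j)

theorem exists_differenceDegreeLT_eval (P : MvPolynomial (Fin n) 𝕜) :
    ∃ k, DifferenceDegreeLT k
      fun x : EuclideanSpace 𝕜 (Fin n) => MvPolynomial.eval (fun i => x i) P := by
  induction P using MvPolynomial.induction_on with
  | C a => exact ⟨1, by simpa using DifferenceDegreeLT.const a⟩
  | add p q hp hq =>
    obtain ⟨k, hk⟩ := hp
    obtain ⟨l, hl⟩ := hq
    refine ⟨max k l, ?_⟩
    simpa using (hk.mono (le_max_left k l)).add (hl.mono (le_max_right k l))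
  | mul_X p i hp =>
    obtain ⟨k, hk⟩ := hp
    refine ⟨k + 2, ?_⟩
    simp only [map_mul, MvPolynomial.eval_X]
    exact hk.mul (DifferenceDegreeLT.linear (EuclideanSpace.proj (𝕜 := 𝕜) i).toLinearMap)

theorem IsPolynomialMap.comp_linear {m : ℕ}
    {f : EuclideanSpace 𝕜 (Fin n) → EuclideanSpace 𝕜 (Fin p)} (hf : IsPolynomialMap f)
    (σ : EuclideanSpace 𝕜 (Fin m) →ₗ[𝕜] EuclideanSpace 𝕜 (Fin n)) : IsPolynomialMap (f ∘ σ) := by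
  obtain ⟨P, hP⟩ := hf
  refine ⟨fun j => MvPolynomial.bind₁
    (fun i => ∑ l, MvPolynomial.C (σ (EuclideanSpace.single l 1) i) * MvPolynomial.X l) (P j),
    fun x j => ?_⟩
  rw [Function.comp_apply, hP, ← MvPolynomial.coe_aeval_eq_eval, ← MvPolynomial.coe_aeval_eq_eval]
  simp only [RingHom.coe_coe]
  rw [MvPolynomial.aeval_bind₁]
  congr 2
  ext i
  have hx : x = ∑ l, x l • EuclideanSpace.single l (1 : 𝕜) := by
    ext i; simp [Finset.sum_apply, Pi.single_apply]
  conv_lhs => rw [hx]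
  simp [mul_comm]

/-- Invariance of a polynomial mapping with bounded translates along a set. -/
theorem IsPolynomialMap.invariant {f : EuclideanSpace 𝕜 (Fin n) → EuclideanSpace 𝕜 (Fin p)}
    (hf : IsPolynomialMap f) {A : Set (EuclideanSpace 𝕜 (Fin n))} {r : ℝ} (hr : 0 < r)
    (hb : ∀ h, ‖h‖ < r → ∃ M : ℝ, ∀ x ∈ A, ‖f (x + h)‖ ≤ M) {u : EuclideanSpace 𝕜 (Fin n)}
    (hu : u ∈ asymptoticSpace 𝕜 A) (x : EuclideanSpace 𝕜 (Fin n)) : f (x + u) = f x := by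
  obtain ⟨P, hP⟩ := hf
  ext j
  rw [hP, hP]
  obtain ⟨k, hk⟩ := exists_differenceDegreeLT_eval (P j)
  refine hk.invariant ((contDiff_eval (P j) (k := 1)).differentiable one_ne_zero) hr (fun h hh => ?_) hu x
  obtain ⟨M, hM⟩ := hb h hh
  refine ⟨M, fun x hx => ?_⟩
  rw [← hP]
  exact (PiLp.norm_apply_le _ _).trans (hM x hx)

end Polynomial

/-! ### Lipschitz triviality implies the factorization -/

section Necessity

variable {𝕜 : Type*} [RCLike 𝕜] {n p : ℕ}
  {f : EuclideanSpace 𝕜 (Fin n) → EuclideanSpace 𝕜 (Fin p)} {c : EuclideanSpace 𝕜 (Fin p)}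

/-- Over a Lipschitz trivial value, the mapping is Lipschitz, it has Lipschitz sections through
every point of the fiber, and nearby fibers are at distance `O(dist t c)`. -/
theorem IsLipschitzTrivialValue.exists_sections (h : IsLipschitzTrivialValue f c) :
    ∃ V ∈ 𝓝 c, ∃ L : NNReal, LipschitzOnWith L f (f ⁻¹' V) ∧
      (∀ x, f x = c → ∃ s : EuclideanSpace 𝕜 (Fin p) → EuclideanSpace 𝕜 (Fin n),
        ∀ t ∈ V, f (s t) = t ∧ dist (s t) x ≤ L * dist t c) ∧
      ∀ y, f y ∈ V → ∃ x, f x = c ∧ dist y x ≤ L * dist (f y) c := by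
  classical
  obtain ⟨V, hV, H, hH, ⟨L₁, hL₁⟩, ⟨L₂, hL₂⟩⟩ := h
  have hcV : c ∈ V := mem_of_mem_nhds hV
  have hsnd (y : f ⁻¹' V) : ((H.symm y).2 : EuclideanSpace 𝕜 (Fin p)) = f y := by
    rw [← hH (H.symm y).1 (H.symm y).2, Prod.mk.eta, H.apply_symm_apply]
  -- `H (x, c) = x` is not assumed, so the section through `x` starts from the first component of
  -- `H.symm x`.
  have hpt (x) (hx : f x ∈ V) : ((H ((H.symm ⟨x, hx⟩).1, ⟨f x, hx⟩) : f ⁻¹' V) :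
      EuclideanSpace 𝕜 (Fin n)) = x := by
    have : ((H.symm ⟨x, hx⟩).1, (⟨f x, hx⟩ : V)) = H.symm ⟨x, hx⟩ :=
      Prod.ext rfl (Subtype.ext (hsnd ⟨x, hx⟩).symm)
    rw [this, H.apply_symm_apply]
  have hdist (x₀ : (f ⁻¹' {c} : Set (EuclideanSpace 𝕜 (Fin n)))) (t t' : V) :
      dist (H (x₀, t) : EuclideanSpace 𝕜 (Fin n)) (H (x₀, t')) ≤ max L₁ L₂ * dist t t' := by
    refine (hL₁.dist_le_mul (x₀, t) (x₀, t')).trans ?_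
    rw [Prod.dist_eq, dist_self, max_eq_right dist_nonneg]
    exact mul_le_mul_of_nonneg_right (by exact_mod_cast le_max_left _ _) dist_nonneg
  refine ⟨V, hV, max L₁ L₂, ?_, fun x hx => ?_, fun y hy => ?_⟩
  · refine LipschitzOnWith.of_dist_le_mul fun x hx y hy => ?_
    have h1 := hL₂.dist_le_mul ⟨x, hx⟩ ⟨y, hy⟩
    have h2 : dist (f x) (f y) ≤ dist (H.symm ⟨x, hx⟩) (H.symm ⟨y, hy⟩) := by
      rw [← hsnd ⟨x, hx⟩, ← hsnd ⟨y, hy⟩, Prod.dist_eq]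
      exact le_max_right _ _
    exact (h2.trans h1).trans
      (mul_le_mul_of_nonneg_right (by exact_mod_cast le_max_right _ _) dist_nonneg)
  · have hxV : f x ∈ V := hx ▸ hcV
    refine ⟨fun t => if ht : t ∈ V then H ((H.symm ⟨x, hxV⟩).1, ⟨t, ht⟩) else x,
      fun t ht => ?_⟩
    simp only [dif_pos ht]
    refine ⟨hH _ _, ?_⟩
    have := hdist (H.symm ⟨x, hxV⟩).1 ⟨t, ht⟩ ⟨f x, hxV⟩
    rw [hpt x hxV] at this
    have hd : dist (⟨t, ht⟩ : V) ⟨f x, hxV⟩ = dist t c := congrArg (dist t) hx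
    rwa [hd] at this
  · refine ⟨H ((H.symm ⟨y, hy⟩).1, ⟨c, hcV⟩), hH _ _, ?_⟩
    have := hdist (H.symm ⟨y, hy⟩).1 ⟨f y, hy⟩ ⟨c, hcV⟩
    rwa [hpt y hy] at this

/-- A mapping with a Lipschitz section through `x` is a submersion at `x`. -/
theorem surjective_fderiv_of_section {x : EuclideanSpace 𝕜 (Fin n)} (hf : DifferentiableAt 𝕜 f x)
    {V : Set (EuclideanSpace 𝕜 (Fin p))} (hV : V ∈ 𝓝 (f x)) {L : ℝ}
    {s : EuclideanSpace 𝕜 (Fin p) → EuclideanSpace 𝕜 (Fin n)}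
    (hs : ∀ t ∈ V, f (s t) = t ∧ dist (s t) x ≤ L * dist t (f x)) :
    Function.Surjective (fderiv 𝕜 f x) := by
  set D := fderiv 𝕜 f x
  have hO : (fun t => s t - x) =O[𝓝 (f x)] fun t => t - f x := by
    refine Asymptotics.IsBigO.of_bound L ?_
    filter_upwards [hV] with t ht
    simpa only [dist_eq_norm] using (hs t ht).2
  have htend : Filter.Tendsto s (𝓝 (f x)) (𝓝 x) := by
    have h0 : Filter.Tendsto (fun t => t - f x) (𝓝 (f x)) (𝓝 0) := by
      have : Continuous fun t => t - f x := by fun_prop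
      simpa using this.tendsto (f x)
    have := (hO.trans_tendsto h0).add_const x
    simpa using this
  have ho := (hf.hasFDerivAt.isLittleO.comp_tendsto htend).trans_isBigO hO
  by_contra hns
  have hlt : LinearMap.range (D : EuclideanSpace 𝕜 (Fin n) →ₗ[𝕜] EuclideanSpace 𝕜 (Fin p)) < ⊤ := by
    rw [lt_top_iff_ne_top, Ne, LinearMap.range_eq_top]
    exact hns
  -- A functional `ℓ` killing the range of `D` satisfies `ℓ (t - f x) = o(t - f x)`, by expanding
  -- `f` along `s`. Its derivative is then zero, contradicting `ℓ ≠ 0`.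
  obtain ⟨ℓ, hℓ0, hℓ⟩ := Submodule.exists_le_ker_of_lt_top _ hlt
  set ℓ' := LinearMap.toContinuousLinearMap ℓ with hℓ'
  have hz : HasFDerivAt ℓ' (0 : EuclideanSpace 𝕜 (Fin p) →L[𝕜] 𝕜) (f x) := by
    refine HasFDerivAt.of_isLittleO ?_
    refine ((ℓ'.isBigO_comp _ _).trans_isLittleO ho).congr' ?_ Filter.EventuallyEq.rfl
    filter_upwards [hV] with t ht
    have hD (v) : ℓ (D v) = 0 := hℓ ⟨v, rfl⟩
    simp [(hs t ht).1, hℓ', D, hD]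
  have := hz.unique ℓ'.hasFDerivAt
  apply hℓ0
  ext v
  exact (DFunLike.congr_fun this v).symm

theorem exists_factorization {m : ℕ} (hf : IsPolynomialMap f)
    (hm : projDim (accAtInfinity (f ⁻¹' {c})) = (n : ℤ) - 1 - (m : ℤ))
    (h : IsLipschitzTrivialValue f c) :
    ∃ (π : EuclideanSpace 𝕜 (Fin n) →ₗ[𝕜] EuclideanSpace 𝕜 (Fin m))
      (g : EuclideanSpace 𝕜 (Fin m) → EuclideanSpace 𝕜 (Fin p)),
      Function.Surjective π ∧ IsPolynomialMap g ∧
        IsRegularValue g c ∧ IsProperAtValue g c ∧ f = g ∘ π := by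
  obtain ⟨V, hV, L, hLip, hsec, hnear⟩ := h.exists_sections
  obtain ⟨ε, hε, hεV⟩ := Metric.nhds_basis_closedBall.mem_iff.1 hV
  have hcV : c ∈ V := mem_of_mem_nhds hV
  have hcont : Continuous f := (hf.contDiff (k := 0)).continuous
  have hdiff : Differentiable 𝕜 f := (hf.contDiff (k := 1)).differentiable one_ne_zero
  have hinv {u} (hu : u ∈ asymptoticSpace 𝕜 (f ⁻¹' {c})) (x) : f (x + u) = f x := by
    refine hf.invariant (r := ε / (L + 1)) (by positivity) (fun v hv => ⟨ε + ‖c‖, ?_⟩) hu x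
    rintro x rfl
    have : dist (f (x + v)) (f x) ≤ ε := by
      -- The Lipschitz bound holds only over `V`. If the segment left the `ε`-ball, some point of it
      -- would lie at image distance exactly `ε`, still over `V`, giving `ε ≤ L ‖v‖ < ε`.
      by_contra! hlt
      have hφ : ContinuousOn (fun τ : ℝ => dist (f (x + (τ : 𝕜) • v)) (f x)) (Set.Icc 0 1) := by
        have : Continuous fun τ : ℝ => (τ : 𝕜) := RCLike.continuous_ofReal
        fun_prop
      obtain ⟨τ, hτ, hτε⟩ := intermediate_value_Icc zero_le_one hφ
        (show ε ∈ Set.Icc _ _ by simpa using ⟨hε.le, hlt.le⟩)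
      have h1 := hLip.dist_le_mul (x + (τ : 𝕜) • v) (hεV hτε.le) x hcV
      simp only at hτε
      rw [hτε, dist_self_add_left, norm_smul, RCLike.norm_ofReal, abs_of_nonneg hτ.1] at h1
      rw [lt_div_iff₀ (by positivity)] at hv
      have h2 : τ * ‖v‖ ≤ ‖v‖ := mul_le_of_le_one_left (norm_nonneg _) hτ.2
      have h3 : (L : ℝ) * (τ * ‖v‖) ≤ L * ‖v‖ := mul_le_mul_of_nonneg_left h2 L.2
      nlinarith [norm_nonneg v]
    calc ‖f (x + v)‖ = ‖(f (x + v) - f x) + f x‖ := by rw [sub_add_cancel]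
      _ ≤ ε + ‖f x‖ := (norm_add_le _ _).trans (by gcongr; rwa [← dist_eq_norm])
  set B := asymptoticSpace 𝕜 (f ⁻¹' {c}) with hB
  have hdim := projDim_accAtInfinity (A := f ⁻¹' {c}) fun u hu x hx => (hinv hu x).trans hx
  have hquot : Module.finrank 𝕜 (EuclideanSpace 𝕜 (Fin n) ⧸ B)
      = Module.finrank 𝕜 (EuclideanSpace 𝕜 (Fin m)) := by
    have := B.finrank_quotient_add_finrank
    rw [finrank_euclideanSpace_fin] at this ⊢
    rw [hm, ← hB] at hdim
    omega
  set e := LinearEquiv.ofFinrankEq _ _ hquot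
  set π : EuclideanSpace 𝕜 (Fin n) →ₗ[𝕜] EuclideanSpace 𝕜 (Fin m) := e.toLinearMap.comp B.mkQ
    with hπ
  have hπs : Function.Surjective π := e.surjective.comp B.mkQ_surjective
  have hker {u} : π u = 0 ↔ u ∈ B := by simp [hπ]
  obtain ⟨σ, hσ⟩ := π.exists_rightInverse_of_surjective (LinearMap.range_eq_top.2 hπs)
  replace hσ (y) : π (σ y) = y := LinearMap.congr_fun hσ y
  have hfac : f = (f ∘ σ) ∘ π := by
    ext1 x
    have hmem : x - σ (π x) ∈ B := by rw [← hker, map_sub, hσ, sub_self]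
    have := hinv hmem (σ (π x))
    rwa [add_sub_cancel] at this
  refine ⟨π, f ∘ σ, hπs, hf.comp_linear σ, ?_, ?_, hfac⟩
  · rintro ⟨y, hy, hyc⟩
    refine hy ?_
    obtain ⟨s, hs⟩ := hsec (σ y) hyc
    have hyc' : f (σ y) = c := hyc
    have hsurj := surjective_fderiv_of_section (hdiff (σ y)) (hyc'.symm ▸ hV) (L := L) (s := s)
      (by rwa [hyc'])
    have hg : Differentiable 𝕜 (f ∘ σ) :=
      ((hf.comp_linear σ).contDiff (k := 1)).differentiable one_ne_zero
    set π' := LinearMap.toContinuousLinearMap π with hπ'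
    have hchain : fderiv 𝕜 f (σ y) = (fderiv 𝕜 (f ∘ σ) y).comp π' := by
      have h1 : HasFDerivAt ((f ∘ σ) ∘ π') ((fderiv 𝕜 (f ∘ σ) y).comp π') (σ y) := by
        refine HasFDerivAt.comp (σ y) ?_ π'.hasFDerivAt
        have : π' (σ y) = y := hσ y
        rw [this]
        exact (hg y).hasFDerivAt
      have h2 : (f ∘ σ) ∘ π' = f := hfac.symm
      rw [h2] at h1
      exact h1.fderiv
    intro v
    obtain ⟨w, hw⟩ := hsurj v
    exact ⟨π' w, by rw [← hw, hchain]; rfl⟩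
  · obtain ⟨M, hM⟩ := exists_norm_le_of_asymptoticSpace_le_ker (A := f ⁻¹' {c}) π
      fun u hu => hker.2 hu
    have hgc : Continuous (f ∘ σ) := hcont.comp σ.continuous_of_finiteDimensional
    set π' := LinearMap.toContinuousLinearMap π with hπ'
    have hcomp : IsCompact ((f ∘ σ) ⁻¹' Metric.closedBall c ε) := by
      refine Metric.isCompact_of_isClosed_isBounded (Metric.isClosed_closedBall.preimage hgc) ?_
      refine isBounded_iff_forall_norm_le.2 ⟨‖π'‖ * (L * ε) + M, fun y hy => ?_⟩
      -- Split `y = π (σ y - x) + π x`: the first term is small since fibers are close, the second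
      -- bounded since `ker π` is the asymptotic space.
      obtain ⟨x, hx, hxy⟩ := hnear (σ y) (hεV hy)
      have hy' : y = π' (σ y - x) + π x := by
        change y = π (σ y - x) + π x
        rw [map_sub, hσ, sub_add_cancel]
      rw [hy']
      refine (norm_add_le _ _).trans (add_le_add ((π'.le_opNorm _).trans ?_) (hM x hx))
      refine mul_le_mul_of_nonneg_left ?_ (norm_nonneg _)
      rw [← dist_eq_norm]
      exact hxy.trans (mul_le_mul_of_nonneg_left hy L.2)
    have : CompactSpace ((f ∘ σ) ⁻¹' Metric.closedBall c ε) := isCompact_iff_compactSpace.1 hcomp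
    exact ⟨Metric.closedBall c ε, Metric.closedBall_mem_nhds c hε,
      (hgc.restrictPreimage).isProperMap⟩

end Necessity

/-! ### Lifting translations by flows -/

section Flow

variable {E G : Type*} [NormedAddCommGroup E] [NormedSpace ℝ E] [NormedAddCommGroup G]
  [NormedSpace ℝ G]

/-- Near a compact set of regular points, the differential has a compactly supported right inverse
up to a cutoff function. -/
theorem exists_cutoff_rightInverse [FiniteDimensional ℝ E] [FiniteDimensional ℝ G] {g : E → G}
    (hg : ContDiff ℝ 2 g) {K : Set E} (hK : IsCompact K)
    (hs : ∀ y ∈ K, Function.Surjective (fderiv ℝ g y)) :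
    ∃ (W : E → G →L[ℝ] E) (χ : E → ℝ), ContDiff ℝ 1 W ∧ HasCompactSupport W ∧ ContDiff ℝ 1 χ ∧
      (∀ y, χ y ∈ Set.Icc (0 : ℝ) 1) ∧ (∀ y ∈ K, χ y = 1) ∧
      ∀ y v, fderiv ℝ g y (W y v) = χ y • v := by
  refine hK.induction_on (p := fun K => ∃ (W : E → G →L[ℝ] E) (χ : E → ℝ), ContDiff ℝ 1 W ∧
      HasCompactSupport W ∧ ContDiff ℝ 1 χ ∧
      (∀ y, χ y ∈ Set.Icc (0 : ℝ) 1) ∧ (∀ y ∈ K, χ y = 1) ∧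
      ∀ y v, fderiv ℝ g y (W y v) = χ y • v) ?_ ?_ ?_ ?_
  · refine ⟨0, 0, contDiff_const, HasCompactSupport.zero, contDiff_const, ?_, ?_, ?_⟩ <;> simp
  · intro s t hst ht
    obtain ⟨W, χ, h1, h2, h3, h4, h5, h6⟩ := ht
    exact ⟨W, χ, h1, h2, h3, h4, fun y hy => h5 y (hst hy), h6⟩
  · intro s t hs ht
    obtain ⟨W₁, χ₁, h1, h2, h3, h4, h5, h6⟩ := hs
    obtain ⟨W₂, χ₂, h1', h2', h3', h4', h5', h6'⟩ := ht
    -- The new cutoff is `1 - (1 - χ₁) (1 - χ₂)`, equal to `1` wherever either one is.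
    refine ⟨fun y => W₁ y + (1 - χ₁ y) • W₂ y, fun y => χ₁ y + (1 - χ₁ y) * χ₂ y,
      h1.add ((contDiff_const.sub h3).smul h1'), HasCompactSupport.add h2 (HasCompactSupport.smul_left (f := fun y => 1 - χ₁ y) h2'),
      h3.add ((contDiff_const.sub h3).mul h3'), fun y => ?_, fun y hy => ?_, fun y v => ?_⟩
    · obtain ⟨a0, a1⟩ := h4 y
      obtain ⟨b0, b1⟩ := h4' y
      constructor <;> nlinarith [mul_nonneg (sub_nonneg.2 a1) (sub_nonneg.2 b1),
        mul_nonneg (sub_nonneg.2 a1) b0]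
    · rcases hy with hy | hy
      · simp [h5 y hy]
      · simp [h5' y hy]
    · simp only [add_apply, smul_apply, map_add, map_smul,
        h6, h6', smul_smul, add_smul]
  · intro y₀ hy₀
    obtain ⟨A, hA⟩ := (fderiv ℝ g y₀ : E →ₗ[ℝ] G).exists_rightInverse_of_surjective
      (LinearMap.range_eq_top.2 (hs y₀ hy₀))
    set A' : G →L[ℝ] E := LinearMap.toContinuousLinearMap A
    -- Since `T` is invertible near `y₀`, `A' ∘ T⁻¹` is a right inverse of the differential there;
    -- the bump is supported where this makes sense.
    set T : E → G →L[ℝ] G := fun y => (fderiv ℝ g y).comp A' with hT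
    have hTd : ContDiff ℝ 1 T := (hg.fderiv_right (by norm_num)).clm_comp contDiff_const
    have hT0 : T y₀ = 1 := by
      ext v
      exact LinearMap.congr_fun hA v
    have hU : {y | IsUnit (T y)} ∈ 𝓝 y₀ := by
      refine hTd.continuous.continuousAt.preimage_mem_nhds (Units.isOpen.mem_nhds ?_)
      rw [hT0]
      exact isUnit_one
    obtain ⟨ε, hε, hεU⟩ := Metric.nhds_basis_closedBall.mem_iff.1 hU
    set φ : ContDiffBump y₀ := ⟨ε / 2, ε, half_pos hε, half_lt_self hε⟩ with hφ
    have hin {y} (hy : y ∈ tsupport φ) : IsUnit (T y) := by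
      rw [φ.tsupport_eq] at hy
      exact hεU hy
    refine ⟨Metric.closedBall y₀ (ε / 2),
      mem_nhdsWithin_of_mem_nhds (Metric.closedBall_mem_nhds _ (half_pos hε)),
      fun y => φ y • A'.comp (Ring.inverse (T y)), φ, ?_, φ.hasCompactSupport.smul_right,
      φ.contDiff, fun y => ⟨φ.nonneg, φ.le_one⟩, fun y hy => φ.one_of_mem_closedBall hy,
      fun y v => ?_⟩
    · refine contDiff_iff_contDiffAt.2 fun y => ?_
      by_cases hy : y ∈ tsupport φ
      swap
      · refine (contDiffAt_const (c := (0 : G →L[ℝ] E))).congr_of_eventuallyEq ?_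
        filter_upwards [notMem_tsupport_iff_eventuallyEq.1 hy] with z hz
        simp [hz]
      have hy' : IsUnit (T y) := hin hy
      have hinv : ContDiffAt ℝ 1 (Ring.inverse : (G →L[ℝ] G) → _) (T y) := by
        obtain ⟨u, hu⟩ := hy'
        rw [← hu]
        exact contDiffAt_ringInverse ℝ u
      exact φ.contDiff.contDiffAt.smul
        (contDiffAt_const.clm_comp (hinv.comp y hTd.contDiffAt))
    · by_cases hy : y ∈ tsupport φ
      · have h1 : T y (Ring.inverse (T y) v) = v := by
          have := congrArg (fun S : G →L[ℝ] G => S v) (Ring.mul_inverse_cancel _ (hin hy))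
          exact this
        simp only [smul_apply, map_smul]
        congr 1
      · simp [image_eq_zero_of_notMem_tsupport hy]

/-- The control system `α' = W(α) v` has solutions on `[0, 1]`. -/
theorem exists_flow [CompleteSpace E] {W : E → G →L[ℝ] E} {K M : NNReal} (hW : LipschitzWith K W)
    (hM : ∀ y, ‖W y‖ ≤ M) :
    ∃ α : E → G → ℝ → E, ∀ x v, α x v 0 = x ∧ ∀ τ ∈ Set.Icc (0 : ℝ) 1,
      HasDerivWithinAt (α x v) (W (α x v τ) v) (Set.Icc 0 1) τ := by
  have hex (x : E) (v : G) : ∃ a : ℝ → E, a 0 = x ∧ ∀ τ ∈ Set.Icc (0 : ℝ) 1,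
      HasDerivWithinAt a (W (a τ) v) (Set.Icc 0 1) τ := by
    -- The speed is at most `M ‖v‖`, so a ball of that radius confines the trajectory for unit time.
    have hpl : IsPicardLindelof (fun _ y => W y v) (tmin := 0) (tmax := 1)
        ⟨0, Set.left_mem_Icc.2 zero_le_one⟩ x (M * ‖v‖₊) 0 (M * ‖v‖₊) (K * ‖v‖₊) := by
      refine ⟨fun t _ => ?_, fun y _ => continuousOn_const, fun t _ y _ => ?_, by simp⟩
      · refine LipschitzWith.lipschitzOnWith (LipschitzWith.of_dist_le_mul fun y z => ?_)
        rw [dist_eq_norm, ← sub_apply]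
        refine ((W y - W z).le_opNorm v).trans ?_
        have := hW.dist_le_mul y z
        rw [dist_eq_norm (W y)] at this
        push_cast
        nlinarith [mul_le_mul_of_nonneg_right this (norm_nonneg v)]
      · push_cast
        exact ((W y).le_opNorm v).trans (mul_le_mul_of_nonneg_right (hM y) (norm_nonneg v))
    exact hpl.exists_eq_forall_mem_Icc_hasDerivWithinAt₀
  choose α hα using hex
  exact ⟨α, hα⟩

theorem hasDerivWithinAt_Ici_of_Icc {a : ℝ → E} {a' : E} {τ : ℝ} (hτ : τ ∈ Set.Ico (0 : ℝ) 1)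
    (h : HasDerivWithinAt a a' (Set.Icc 0 1) τ) : HasDerivWithinAt a a' (Set.Ici τ) τ :=
  h.mono_of_mem_nhdsWithin (Icc_mem_nhdsGE_of_mem hτ)

variable {W : E → G →L[ℝ] E} {K M : NNReal} {α : E → G → ℝ → E}

theorem lipschitzWith_apply (hW : LipschitzWith K W) {R : NNReal} {v : G} (hv : ‖v‖ ≤ R) :
    LipschitzWith (K * R + 1) fun y => W y v := by
  refine LipschitzWith.of_dist_le_mul fun y z => ?_
  rw [dist_eq_norm, ← sub_apply]
  refine ((W y - W z).le_opNorm v).trans ?_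
  have h1 := hW.dist_le_mul y z
  rw [dist_eq_norm (W y)] at h1
  have h2 := mul_le_mul h1 hv (norm_nonneg v) (by positivity)
  push_cast
  nlinarith [dist_nonneg (x := y) (y := z)]

/-- Grönwall: a trajectory for `v'` solves the equation for `v` up to an error `M * dist v v'`. The
`+ 1` in the rate keeps it nonzero. -/
theorem flow_lipschitzOnWith (hW : LipschitzWith K W) (hM : ∀ y, ‖W y‖ ≤ M)
    (hα : ∀ x v, α x v 0 = x ∧ ∀ τ ∈ Set.Icc (0 : ℝ) 1,
      HasDerivWithinAt (α x v) (W (α x v τ) v) (Set.Icc 0 1) τ) (R : NNReal) :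
    ∃ C : NNReal, LipschitzOnWith C (fun z : E × G => α z.1 z.2 1)
      (Set.univ ×ˢ Metric.closedBall 0 R) := by
  set k : NNReal := K * R + 1 with hk
  have hkpos : (0 : ℝ) < k := by rw [hk]; positivity
  have hexp : 0 ≤ Real.exp k - 1 := by linarith [Real.add_one_le_exp (k : ℝ)]
  refine ⟨⟨Real.exp k + M / k * (Real.exp k - 1), by positivity⟩,
    LipschitzOnWith.of_dist_le_mul ?_⟩
  rintro ⟨x, v⟩ ⟨-, hv⟩ ⟨x', v'⟩ -
  have hv' : ‖v‖ ≤ R := by simpa using hv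
  have hc (x v) : ContinuousOn (α x v) (Set.Icc 0 1) :=
    fun τ hτ => ((hα x v).2 τ hτ).continuousWithinAt
  have := dist_le_of_approx_trajectories_ODE (v := fun _ y => W y v) (δ := dist x x') (εf := 0)
    (εg := M * dist v v')
    (fun _ => lipschitzWith_apply hW hv') (hc x v)
    (fun τ hτ => hasDerivWithinAt_Ici_of_Icc hτ ((hα x v).2 τ (Set.Ico_subset_Icc_self hτ)))
    (fun τ hτ => (dist_self _).le) (hc x' v')
    (fun τ hτ => hasDerivWithinAt_Ici_of_Icc hτ ((hα x' v').2 τ (Set.Ico_subset_Icc_self hτ)))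
    (fun τ hτ => ?_) (by rw [(hα x v).1, (hα x' v').1]) 1 (Set.right_mem_Icc.2 zero_le_one)
  · refine this.trans ?_
    rw [gronwallBound_of_K_ne_0 hkpos.ne']
    have h1 : dist x x' ≤ dist (x, v) (x', v') := le_max_left _ _
    have h2 : dist v v' ≤ dist (x, v) (x', v') := le_max_right _ _
    have h3 : M * dist v v' / k * (Real.exp k - 1) ≤
        M * dist (x, v) (x', v') / k * (Real.exp k - 1) := by gcongr
    have h4 := mul_le_mul_of_nonneg_right h1 (Real.exp_pos k).le
    simp only [sub_zero, mul_one, zero_add]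
    refine (add_le_add h4 h3).trans (le_of_eq ?_)
    change _ = (Real.exp k + M / k * (Real.exp k - 1)) * dist (x, v) (x', v')
    ring
  · rw [dist_eq_norm, ← map_sub, dist_comm v v', dist_eq_norm v' v]
    exact ((W _).le_opNorm _).trans (mul_le_mul_of_nonneg_right (hM _) (norm_nonneg _))

/-- The time-reversed trajectory solves the equation for `-v`; uniqueness concludes. -/
theorem flow_neg (hW : LipschitzWith K W)
    (hα : ∀ x v, α x v 0 = x ∧ ∀ τ ∈ Set.Icc (0 : ℝ) 1,
      HasDerivWithinAt (α x v) (W (α x v τ) v) (Set.Icc 0 1) τ) (x : E) (v : G) :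
    α (α x v 1) (-v) 1 = x := by
  have hc (x v) : ContinuousOn (α x v) (Set.Icc 0 1) :=
    fun τ hτ => ((hα x v).2 τ hτ).continuousWithinAt
  have hmaps : Set.MapsTo (fun τ : ℝ => 1 - τ) (Set.Icc 0 1) (Set.Icc 0 1) :=
    fun τ hτ => ⟨by linarith [hτ.2], by linarith [hτ.1]⟩
  have hrev (τ) (hτ : τ ∈ Set.Icc (0 : ℝ) 1) : HasDerivWithinAt (fun τ => α x v (1 - τ))
      (W (α x v (1 - τ)) (-v)) (Set.Icc 0 1) τ := by
    have h1 : HasDerivWithinAt (fun τ : ℝ => 1 - τ) (-1) (Set.Icc 0 1) τ := by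
      simpa using (hasDerivWithinAt_id τ (Set.Icc (0 : ℝ) 1)).const_sub 1
    have := HasDerivWithinAt.scomp τ ((hα x v).2 (1 - τ) (hmaps hτ)) h1 hmaps
    rw [neg_one_smul, ← map_neg] at this
    exact this
  have := ODE_solution_unique (v := fun _ y => W y (-v)) (f := α (α x v 1) (-v))
    (g := fun τ => α x v (1 - τ))
    (fun _ => lipschitzWith_apply hW (R := ‖-v‖₊) le_rfl) (hc _ _)
    (fun τ hτ => hasDerivWithinAt_Ici_of_Icc hτ ((hα _ _).2 τ (Set.Ico_subset_Icc_self hτ)))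
    (fun τ hτ => (hrev τ hτ).continuousWithinAt)
    (fun τ hτ => hasDerivWithinAt_Ici_of_Icc hτ (hrev τ (Set.Ico_subset_Icc_self hτ)))
    (by simp [(hα (α x v 1) (-v)).1]) (Set.right_mem_Icc.2 zero_le_one)
  simpa [(hα x v).1] using this

/-- Along the flow `g` has velocity `χ • v`, so it stays on the line through `g x`, at parameter `θ
= ∫ χ`. As `0 ≤ χ ≤ 1`, `θ` lies in `[0, 1]` a priori; convexity keeps `g` in `S`, where `χ = 1`,
whence `θ 1 = 1`. -/
theorem map_flow {g : E → G} (hg : Differentiable ℝ g) {χ : E → ℝ} (hχc : Continuous χ)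
    (hχ : ∀ y, χ y ∈ Set.Icc (0 : ℝ) 1) (hWχ : ∀ y v, fderiv ℝ g y (W y v) = χ y • v)
    {S : Set G} (hS : Convex ℝ S) (hSχ : ∀ y, g y ∈ S → χ y = 1)
    (hα : ∀ x v, α x v 0 = x ∧ ∀ τ ∈ Set.Icc (0 : ℝ) 1,
      HasDerivWithinAt (α x v) (W (α x v τ) v) (Set.Icc 0 1) τ) {x : E} {v : G}
    (hx : g x ∈ S) (hv : g x + v ∈ S) : g (α x v 1) = g x + v := by
  have hc : ContinuousOn (α x v) (Set.Icc 0 1) :=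
    fun τ hτ => ((hα x v).2 τ hτ).continuousWithinAt
  -- The trajectory is controlled only on `[0, 1]`; clamping time makes the integrand continuous on
  -- `ℝ`.
  set ψ : ℝ → ℝ := fun τ => χ (α x v (Set.projIcc 0 1 zero_le_one τ)) with hψ
  have hψc : Continuous ψ :=
    hχc.comp (hc.comp_continuous (continuous_subtype_val.comp continuous_projIcc) fun τ =>
      (Set.projIcc (0 : ℝ) 1 zero_le_one τ).2)
  have hψα {τ} (hτ : τ ∈ Set.Icc (0 : ℝ) 1) : ψ τ = χ (α x v τ) := by
    simp [hψ, Set.projIcc_of_mem _ hτ]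
  set θ : ℝ → ℝ := fun τ => ∫ s in (0 : ℝ)..τ, ψ s with hθ
  have hder (τ) (hτ : τ ∈ Set.Icc (0 : ℝ) 1) :
      HasDerivWithinAt (fun τ => g (α x v τ) - θ τ • v) 0 (Set.Icc 0 1) τ := by
    have h1 := (hg (α x v τ)).hasFDerivAt.comp_hasDerivWithinAt τ ((hα x v).2 τ hτ)
    have h2 : HasDerivAt θ (ψ τ) τ := (hψc.integral_hasStrictDerivAt 0 τ).hasDerivAt
    have h3 := h1.sub (h2.hasDerivWithinAt.smul_const v)
    rw [hWχ, hψα hτ, sub_self] at h3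
    exact h3
  have hconst (τ) (hτ : τ ∈ Set.Icc (0 : ℝ) 1) : g (α x v τ) = g x + θ τ • v := by
    have := constant_of_has_deriv_right_zero (fun τ hτ => (hder τ hτ).continuousWithinAt)
      (fun τ hτ => hasDerivWithinAt_Ici_of_Icc hτ (hder τ (Set.Ico_subset_Icc_self hτ))) τ hτ
    simp only [hθ, intervalIntegral.integral_same, zero_smul, sub_zero, (hα x v).1] at this
    rw [← this, sub_add_cancel]
  have hθ_mem (τ) (hτ : τ ∈ Set.Icc (0 : ℝ) 1) : θ τ ∈ Set.Icc (0 : ℝ) 1 := by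
    refine ⟨intervalIntegral.integral_nonneg hτ.1 fun s _ => (hχ _).1, ?_⟩
    have := intervalIntegral.integral_mono_on (μ := MeasureTheory.volume) hτ.1 (hψc.intervalIntegrable 0 τ)
      (continuous_const.intervalIntegrable 0 τ) fun s _ => (hχ (α x v (Set.projIcc 0 1 zero_le_one s))).2
    rw [intervalIntegral.integral_const, sub_zero, smul_eq_mul, mul_one] at this
    exact this.trans hτ.2
  have hψ1 (τ) (hτ : τ ∈ Set.Icc (0 : ℝ) 1) : ψ τ = 1 := by
    rw [hψα hτ]
    refine hSχ _ ?_
    rw [hconst τ hτ]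
    exact hS.add_smul_mem hx hv (hθ_mem τ hτ)
  have hθ1 : θ 1 = 1 := by
    rw [hθ]
    simp only
    rw [intervalIntegral.integral_congr (g := fun _ => (1 : ℝ)) fun s hs => hψ1 s (by
      rwa [Set.uIcc_of_le zero_le_one] at hs)]
    simp
  rw [hconst 1 (Set.right_mem_Icc.2 zero_le_one), hθ1, one_smul]

/-- A Lipschitz lift of the translations of the target over a ball with compact regular
preimage. -/
theorem exists_lipschitz_transport [FiniteDimensional ℝ E] [FiniteDimensional ℝ G] {g : E → G}
    (hg : ContDiff ℝ 2 g) {c : G} {r : NNReal} (hK : IsCompact (g ⁻¹' Metric.closedBall c r))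
    (hs : ∀ y ∈ g ⁻¹' Metric.closedBall c r, Function.Surjective (fderiv ℝ g y)) :
    ∃ Φ : E × G → E, (∃ C : NNReal, LipschitzOnWith C Φ (Set.univ ×ˢ Metric.closedBall 0 r)) ∧
      (∀ x v, Φ (Φ (x, v), -v) = x) ∧
      ∀ x v, g x ∈ Metric.closedBall c r → g x + v ∈ Metric.closedBall c r →
        g (Φ (x, v)) = g x + v := by
  obtain ⟨W, χ, hWd, hWs, hχd, hχ, hχK, hWχ⟩ := exists_cutoff_rightInverse hg hK hs
  obtain ⟨K, hWL⟩ := hWd.lipschitzWith_of_hasCompactSupport hWs one_ne_zero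
  obtain ⟨M, hM⟩ := hWs.exists_bound_of_continuous hWd.continuous
  have hM' (y) : ‖W y‖ ≤ (⟨max M 0, le_max_right _ _⟩ : NNReal) := (hM y).trans (le_max_left _ _)
  have : CompleteSpace E := FiniteDimensional.complete ℝ E
  obtain ⟨α, hα⟩ := exists_flow hWL hM'
  exact ⟨fun z => α z.1 z.2 1, flow_lipschitzOnWith hWL hM' hα r, flow_neg hWL hα,
    fun x v => map_flow (hg.differentiable two_ne_zero) hχd.continuous hχ hWχ
      (convex_closedBall c (r : ℝ)) hχK hα⟩

end Flow

/-! ### The factorization implies Lipschitz triviality -/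

section Sufficiency

theorem isOpen_setOf_surjective_fderiv {E G : Type*} [NormedAddCommGroup E] [NormedSpace ℝ E]
    [NormedAddCommGroup G] [NormedSpace ℝ G] [FiniteDimensional ℝ E] [FiniteDimensional ℝ G]
    {g : E → G} (hg : ContDiff ℝ 1 g) : IsOpen {y | Function.Surjective (fderiv ℝ g y)} := by
  rw [isOpen_iff_mem_nhds]
  intro y₀ hy₀
  obtain ⟨A, hA⟩ := (fderiv ℝ g y₀ : E →ₗ[ℝ] G).exists_rightInverse_of_surjective
    (LinearMap.range_eq_top.2 hy₀)
  set T : E → G →L[ℝ] G := fun y => (fderiv ℝ g y).comp (LinearMap.toContinuousLinearMap A)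
    with hT
  have hTc : Continuous T := (hg.continuous_fderiv one_ne_zero).clm_comp continuous_const
  have hT0 : T y₀ = 1 := by
    ext v
    exact LinearMap.congr_fun hA v
  filter_upwards [hTc.continuousAt.preimage_mem_nhds
    (Units.isOpen.mem_nhds (hT0 ▸ isUnit_one : IsUnit (T y₀)))] with y hy v
  have h1 : T y (Ring.inverse (T y) v) = v :=
    congrArg (fun S : G →L[ℝ] G => S v) (Ring.mul_inverse_cancel _ hy)
  exact ⟨_, h1⟩

variable {𝕜 : Type*} [RCLike 𝕜] {n m p : ℕ}

/-- A Lipschitz transport along a Lipschitz mapping yields a Lipschitz trivialization. -/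
theorem isLipschitzTrivialValue_of_transport
    {f : EuclideanSpace 𝕜 (Fin n) → EuclideanSpace 𝕜 (Fin p)} {c : EuclideanSpace 𝕜 (Fin p)}
    {r : NNReal} (hr : 0 < r) {L C : NNReal}
    (hL : LipschitzOnWith L f (f ⁻¹' Metric.closedBall c r))
    {Φ : EuclideanSpace 𝕜 (Fin n) × EuclideanSpace 𝕜 (Fin p) → EuclideanSpace 𝕜 (Fin n)}
    (hC : LipschitzOnWith C Φ (Set.univ ×ˢ Metric.closedBall 0 r))
    (hneg : ∀ x v, Φ (Φ (x, v), -v) = x)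
    (hmap : ∀ x v, f x ∈ Metric.closedBall c r → f x + v ∈ Metric.closedBall c r →
      f (Φ (x, v)) = f x + v) : IsLipschitzTrivialValue f c := by
  have hc : c ∈ Metric.closedBall c (r : ℝ) := Metric.mem_closedBall_self r.2
  have hto (x : (f ⁻¹' {c} : Set (EuclideanSpace 𝕜 (Fin n)))) (t : Metric.closedBall c (r : ℝ)) :
      f (Φ (x, t - c)) = t := by
    have hx : f x = c := x.2
    rw [hmap x (t - c) (by rwa [hx]) (by rw [hx, add_sub_cancel]; exact t.2), hx, add_sub_cancel]
  have hinv (y : (f ⁻¹' Metric.closedBall c r : Set (EuclideanSpace 𝕜 (Fin n)))) :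
      f (Φ (y, c - f y)) = c := by
    rw [hmap y (c - f y) y.2 (by rwa [add_sub_cancel]), add_sub_cancel]
  have hball (t : Metric.closedBall c (r : ℝ)) :
      (t : EuclideanSpace 𝕜 (Fin p)) - c ∈ Metric.closedBall 0 (r : ℝ) := by
    rw [mem_closedBall_zero_iff, ← dist_eq_norm]
    exact t.2
  have hball' (y : (f ⁻¹' Metric.closedBall c r : Set (EuclideanSpace 𝕜 (Fin n)))) :
      c - f y ∈ Metric.closedBall 0 (r : ℝ) := by
    rw [mem_closedBall_zero_iff, ← dist_eq_norm, dist_comm]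
    exact y.2
  -- Transport by `t - c` out of the central fiber, and by `c - f y` back to it.
  let F : (f ⁻¹' {c} : Set (EuclideanSpace 𝕜 (Fin n))) × Metric.closedBall c (r : ℝ) →
      (f ⁻¹' Metric.closedBall c r : Set (EuclideanSpace 𝕜 (Fin n))) :=
    fun z => ⟨Φ (z.1, z.2 - c), by rw [Set.mem_preimage, hto]; exact z.2.2⟩
  let F' : (f ⁻¹' Metric.closedBall c r : Set (EuclideanSpace 𝕜 (Fin n))) →
      (f ⁻¹' {c} : Set (EuclideanSpace 𝕜 (Fin n))) × Metric.closedBall c (r : ℝ) :=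
    fun y => (⟨Φ (y, c - f y), hinv y⟩, ⟨f y, y.2⟩)
  have hF : LipschitzWith C F := by
    refine LipschitzWith.of_dist_le_mul fun z z' => ?_
    refine (hC.dist_le_mul (z.1, z.2 - c) ⟨trivial, hball _⟩ (z'.1, z'.2 - c)
      ⟨trivial, hball _⟩).trans (le_of_eq ?_)
    rw [Prod.dist_eq, Prod.dist_eq, dist_sub_right]
    rfl
  have hF' : LipschitzWith (max (C * (1 + L)) L) F' := by
    refine LipschitzWith.of_dist_le_mul fun y y' => ?_
    have hL' := hL.dist_le_mul y y.2 y' y'.2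
    rw [Prod.dist_eq]
    refine max_le ?_ ?_
    · refine (hC.dist_le_mul (↑y, c - f y) ⟨trivial, hball' _⟩ (↑y', c - f y')
        ⟨trivial, hball' _⟩).trans ?_
      have h1 : dist ((y : EuclideanSpace 𝕜 (Fin n)), c - f y) ((y' : EuclideanSpace 𝕜 (Fin n)), c - f y')
          ≤ (1 + L) * dist y y' := by
        rw [Prod.dist_eq, dist_sub_left]
        refine max_le ?_ (hL'.trans ?_)
        · change dist y y' ≤ _
          nlinarith [dist_nonneg (x := y) (y := y'), L.2, mul_nonneg L.2 (dist_nonneg (x := y) (y := y'))]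
        · change _ * dist y y' ≤ _
          nlinarith [dist_nonneg (x := y) (y := y')]
      refine (mul_le_mul_of_nonneg_left h1 C.2).trans ?_
      rw [← mul_assoc]
      exact mul_le_mul_of_nonneg_right (by exact_mod_cast le_max_left (C * (1 + L)) L) dist_nonneg
    · exact hL'.trans (mul_le_mul_of_nonneg_right (by exact_mod_cast le_max_right _ _) dist_nonneg)
  refine ⟨Metric.closedBall c r, Metric.closedBall_mem_nhds c (by exact_mod_cast hr),
    { toFun := F
      invFun := F'
      left_inv := fun z => ?_
      right_inv := fun y => ?_
      continuous_toFun := hF.continuous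
      continuous_invFun := hF'.continuous }, hto, ⟨_, hF⟩, ⟨_, hF'⟩⟩
  · refine Prod.ext (Subtype.ext ?_) (Subtype.ext (hto z.1 z.2))
    change Φ (Φ (z.1, z.2 - c), c - f (Φ (z.1, z.2 - c))) = z.1
    rw [hto, ← neg_sub (z.2 : EuclideanSpace 𝕜 (Fin p)) c, hneg]
  · refine Subtype.ext ?_
    change Φ (Φ (y, c - f y), f y - c) = y
    rw [← neg_sub c (f y), hneg]

theorem isLipschitzTrivialValue_of_factorization
    {π : EuclideanSpace 𝕜 (Fin n) →ₗ[𝕜] EuclideanSpace 𝕜 (Fin m)}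
    {g : EuclideanSpace 𝕜 (Fin m) → EuclideanSpace 𝕜 (Fin p)} {c : EuclideanSpace 𝕜 (Fin p)}
    (hπ : Function.Surjective π) (hg : IsPolynomialMap g) (hreg : IsRegularValue g c)
    (hprop : IsProperAtValue g c) : IsLipschitzTrivialValue (g ∘ π) c := by
  have hfinE : FiniteDimensional ℝ (EuclideanSpace 𝕜 (Fin m)) :=
    FiniteDimensional.trans ℝ 𝕜 _
  have hfinG : FiniteDimensional ℝ (EuclideanSpace 𝕜 (Fin p)) :=
    FiniteDimensional.trans ℝ 𝕜 _
  have hgR (k : WithTop ℕ∞) : ContDiff ℝ k g := hg.contDiff.restrict_scalars ℝ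
  obtain ⟨V, hV, hprop⟩ := hprop
  obtain ⟨r₁, hr₁, hr₁V⟩ := Metric.nhds_basis_closedBall.mem_iff.1 hV
  have hK₁ : IsCompact (g ⁻¹' Metric.closedBall c r₁) := by
    have h1 : IsCompact ((↑) ⁻¹' Metric.closedBall c r₁ : Set V) := by
      rw [Subtype.isCompact_iff, Subtype.image_preimage_coe, Set.inter_eq_right.2 hr₁V]
      exact isCompact_closedBall c r₁
    have h2 := (hprop.isCompact_preimage h1).image continuous_subtype_val
    convert h2 using 1
    ext y
    constructor
    · exact fun hy => ⟨⟨y, hr₁V hy⟩, hy, rfl⟩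
    · rintro ⟨z, hz, rfl⟩
      exact hz
  -- The critical values from this compact preimage form a compact set missing `c`, so a smaller
  -- ball avoids them.
  set Z := g '' (g ⁻¹' Metric.closedBall c r₁ ∩ {y | Function.Surjective (fderiv ℝ g y)}ᶜ) with hZ
  have hZc : IsCompact Z := (hK₁.inter_right
    (isOpen_setOf_surjective_fderiv (hgR 1)).isClosed_compl).image (hgR 0).continuous
  have hfd (y) : fderiv ℝ g y = (fderiv 𝕜 g y).restrictScalars ℝ :=
    (((hg.contDiff (k := 1)).differentiable one_ne_zero) y).fderiv_restrictScalars ℝ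
  have hcZ : c ∉ Z := by
    rintro ⟨y, ⟨-, hy⟩, hyc⟩
    refine hreg ⟨y, fun hs => hy ?_, hyc⟩
    change Function.Surjective (fderiv ℝ g y)
    rw [hfd]
    exact hs
  obtain ⟨r₂, hr₂, hr₂Z⟩ := Metric.nhds_basis_closedBall.mem_iff.1
    (hZc.isClosed.isOpen_compl.mem_nhds hcZ)
  set r : NNReal := ⟨min r₁ r₂, (lt_min hr₁ hr₂).le⟩
  have hr : 0 < r := lt_min hr₁ hr₂
  have hsub : g ⁻¹' Metric.closedBall c r ⊆ g ⁻¹' Metric.closedBall c r₁ :=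
    Set.preimage_mono (Metric.closedBall_subset_closedBall (min_le_left _ _))
  have hK : IsCompact (g ⁻¹' Metric.closedBall c r) :=
    hK₁.of_isClosed_subset (Metric.isClosed_closedBall.preimage (hgR 0).continuous) hsub
  have hs (y) (hy : y ∈ g ⁻¹' Metric.closedBall c r) : Function.Surjective (fderiv ℝ g y) := by
    by_contra hns
    exact hr₂Z (Metric.closedBall_subset_closedBall (min_le_right _ _) hy) ⟨y, ⟨hsub hy, hns⟩, rfl⟩
  obtain ⟨Φ, ⟨C, hC⟩, hneg, hmap⟩ := exists_lipschitz_transport (hgR 2) hK hs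
  obtain ⟨R, hR⟩ := hK.isBounded.subset_closedBall 0
  obtain ⟨L, hL⟩ := (hgR 1).contDiffOn.exists_lipschitzOnWith one_ne_zero
    (convex_closedBall (0 : EuclideanSpace 𝕜 (Fin m)) R) (isCompact_closedBall _ _)
  obtain ⟨σ, hσ⟩ := π.exists_rightInverse_of_surjective (LinearMap.range_eq_top.2 hπ)
  replace hσ (y) : π (σ y) = y := LinearMap.congr_fun hσ y
  set π' := LinearMap.toContinuousLinearMap π
  set σ' := LinearMap.toContinuousLinearMap σ
  have hπL : LipschitzWith ‖π'‖₊ π := π'.lipschitz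
  have hσL : LipschitzWith ‖σ'‖₊ σ := σ'.lipschitz
  have hfL : LipschitzOnWith (L * ‖π'‖₊) (g ∘ π) ((g ∘ π) ⁻¹' Metric.closedBall c r) :=
    hL.comp hπL.lipschitzOnWith fun x hx => hR hx
  -- Only the component in the range of `σ` moves, by the transport of `g`; the component in `ker π`
  -- is preserved.
  set Ψ : EuclideanSpace 𝕜 (Fin n) × EuclideanSpace 𝕜 (Fin p) → EuclideanSpace 𝕜 (Fin n) :=
    fun z => z.1 + σ (Φ (π z.1, z.2) - π z.1) with hΨ
  have hπΨ (x v) : π (Ψ (x, v)) = Φ (π x, v) := by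
    simp only [hΨ, map_add, hσ, add_sub_cancel]
  have hπL' : LipschitzWith (max (‖π'‖₊ * 1) 1)
      (fun z : EuclideanSpace 𝕜 (Fin n) × EuclideanSpace 𝕜 (Fin p) => (π z.1, z.2)) :=
    (hπL.comp LipschitzWith.prod_fst).prodMk LipschitzWith.prod_snd
  have hΨL := (LipschitzWith.prod_fst.lipschitzOnWith (s := Set.univ ×ˢ Metric.closedBall 0 (r : ℝ))).add
    (hσL.comp_lipschitzOnWith ((hC.comp hπL'.lipschitzOnWith
      (s := Set.univ ×ˢ Metric.closedBall 0 (r : ℝ)) fun z hz => ⟨trivial, hz.2⟩).sub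
      ((hπL.comp LipschitzWith.prod_fst).lipschitzOnWith)))
  refine isLipschitzTrivialValue_of_transport hr hfL (Φ := Ψ) hΨL (fun x v => ?_)
    fun x v hx hv => ?_
  · change Ψ (x, v) + σ (Φ (π (Ψ (x, v)), -v) - π (Ψ (x, v))) = x
    rw [hπΨ, hneg]
    simp only [hΨ, map_sub]
    abel
  · change g (π (Ψ (x, v))) = _
    rw [hπΨ]
    exact hmap _ _ hx hv

end Sufficiency

end LipTriv

end

theorem mainTheorem1 {𝕜 : Type*} [RCLike 𝕜] (n p m : ℕ)
    (f : EuclideanSpace 𝕜 (Fin n) → EuclideanSpace 𝕜 (Fin p))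
    (hf : LipTriv.IsPolynomialMap f) (c : EuclideanSpace 𝕜 (Fin p))
    (hm : LipTriv.projDim (LipTriv.accAtInfinity (f ⁻¹' {c})) = (n : ℤ) - 1 - (m : ℤ)) :
    LipTriv.IsLipschitzTrivialValue f c ↔
      ∃ (π : EuclideanSpace 𝕜 (Fin n) →ₗ[𝕜] EuclideanSpace 𝕜 (Fin m))
        (g : EuclideanSpace 𝕜 (Fin m) → EuclideanSpace 𝕜 (Fin p)),
        Function.Surjective π ∧ LipTriv.IsPolynomialMap g ∧
          LipTriv.IsRegularValue g c ∧ LipTriv.IsProperAtValue g c ∧ f = g ∘ π := by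
  refine ⟨LipTriv.exists_factorization hf hm, ?_⟩
  rintro ⟨π, g, hπ, hg, hreg, hprop, rfl⟩
  exact LipTriv.isLipschitzTrivialValue_of_factorization hπ hg hreg hprop
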